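/- Let $\mathbb D=\{z\in\mathbb C:|z|<1\}$ and $\mathbb T=\partial\mathbb D$. Let $(\phi_t)_{t\ge 0}$ be a non-trivial one-parameter semigroup in $\mathbb D$: each $\phi_t:\mathbb D\to\mathbb D$ is holomorphic, $\phi_0=\mathrm{id}_{\mathbb D}$, $\phi_{t+s}=\phi_t\circ\phi_s$ for all $t,s\ge0$, $\phi_t(z)\to z$ as $t\to0^+$ for every $z\in\mathbb D$, and $\phi_t\ne\mathrm{id}_{\mathbb D}$ for some $t$. Suppose that its Denjoy–Wolff point $\tau$ lies on $\mathbb T$, i.e. for each $\phi_t\neq\mathrm{id}_{\mathbb D}$ the angular limit of $\phi_t$ at $\tau$ equals $\tau$ and the angular derivative $\phi_t'(\tau)$ exists finitely with $|\phi_t'(\tau)|\le 1$. Let $h$ be a Koenigs function of $(\phi_t)$, i.e. a univalent holomorphic function $h:\mathbb D\to\mathbb C$ with $h\circ\phi_t=h+t$ for all $t\ge0$. **Proposition 4.6.** Let $\sigma\in\mathbb T$ and assume that the unrestricted limit $\lim_{\mathbb D\ni z\to\sigma}h(z)$ exists, finite or infinite (that is, in $\mathbb C\cup\{\infty\}$).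 Then for every $t\ge0$ the function $\phi_t$ has a finite unrestricted limit at $\sigma$, equal to its angular limit $\phi_t(\sigma)$ at $\sigma$, and the convergence $\phi_t(z)\to\phi_t(\sigma)$ as $\mathbb D\ni z\to\sigma$ is locally uniform with respect to $t\in[0,+\infty)$. -/

import Mathlib

open Filter Topology Set
open scoped NNReal

/-- The open unit disk `𝔻` in the complex plane. -/
def unitDisk : Set ℂ := {z : ℂ | ‖z‖ < 1}

/-- The Stolz angle with vertex `σ` on the unit circle and aperture parameter `M > 1`. -/
def stolzAngle (σ : ℂ) (M : ℝ) : Set ℂ := {z : ℂ | ‖z‖ < 1 ∧ ‖z - σ‖ < M * (1 - ‖z‖)}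

/-- `f` has the angular limit `L` at the point `σ` of the unit circle: it tends to `L` inside
every Stolz angle with vertex `σ`. -/
def HasAngularLimit (f : ℂ → ℂ) (σ L : ℂ) : Prop :=
  ∀ M : ℝ, 1 < M → Tendsto f (𝓝[stolzAngle σ M] σ) (𝓝 L)

/-- `f` has the unrestricted limit `L` at `σ`: `f z` tends to `L` as `z` tends to `σ` in `𝔻`. -/
def HasUnrestrictedLimit (f : ℂ → ℂ) (σ L : ℂ) : Prop :=
  Tendsto f (𝓝[unitDisk] σ) (𝓝 L)

/-- `f` has the unrestricted limit `∞` at `σ`. -/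
def HasInfiniteUnrestrictedLimit (f : ℂ → ℂ) (σ : ℂ) : Prop :=
  Tendsto f (𝓝[unitDisk] σ) (Bornology.cobounded ℂ)

/-- A one-parameter semigroup of holomorphic self-maps of the unit disk. Only the values of
`φ t` on the disk matter. -/
structure IsOneParameterSemigroup (φ : ℝ≥0 → ℂ → ℂ) : Prop where
  holomorphic : ∀ t, DifferentiableOn ℂ (φ t) unitDisk
  mapsTo : ∀ t, MapsTo (φ t) unitDisk unitDisk
  zero : ∀ z ∈ unitDisk, φ 0 z = z
  add : ∀ t s, ∀ z ∈ unitDisk, φ (t + s) z = φ t (φ s z)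
  tendsto_zero : ∀ z ∈ unitDisk, Tendsto (fun t : ℝ≥0 => φ t z) (𝓝[>] 0) (𝓝 z)

/-- `τ` is the Denjoy-Wolff point of a holomorphic self-map `f ≠ id` of the disk: the fixed
point of `f` in the closed disk with `|f'(τ)| ≤ 1`. If `τ` is on the circle, then `f(τ)` is an
angular limit and `f'(τ)` is the (finite) angular derivative. -/
def IsDenjoyWolffPoint (f : ℂ → ℂ) (τ : ℂ) : Prop :=
  (‖τ‖ < 1 ∧ f τ = τ ∧ ‖deriv f τ‖ ≤ 1) ∨
  (‖τ‖ = 1 ∧ HasAngularLimit f τ τ ∧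
    ∃ d : ℂ, ‖d‖ ≤ 1 ∧ HasAngularLimit (fun z => (f z - τ) / (z - τ)) τ d)

/-- `τ` is the Denjoy-Wolff point of the non-trivial one-parameter semigroup `φ`: the semigroup
contains an element different from the identity, and `τ` is the Denjoy-Wolff point of all such
elements. -/
def IsSemigroupDenjoyWolffPoint (φ : ℝ≥0 → ℂ → ℂ) (τ : ℂ) : Prop :=
  (∃ t, ¬ EqOn (φ t) id unitDisk) ∧
    ∀ t, ¬ EqOn (φ t) id unitDisk → IsDenjoyWolffPoint (φ t) τ

/-- `h` is a Koenigs function of a one-parameter semigroup `φ` whose Denjoy-Wolff point lies on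
the unit circle: a univalent holomorphic solution in the disk of the Abel equations
`h ∘ φ t = h + t`. No normalization is imposed. -/
structure IsKoenigsFunction (φ : ℝ≥0 → ℂ → ℂ) (h : ℂ → ℂ) : Prop where
  holomorphic : DifferentiableOn ℂ h unitDisk
  univalent : InjOn h unitDisk
  abel : ∀ t : ℝ≥0, ∀ z ∈ unitDisk, h (φ t z) = h z + ((t : ℝ) : ℂ)

/-! By the Abel equation, `h` is close to `L + t`, or to `∞`, on the connected set `φ t '' (ball σ δ
∩ unitDisk)` for small `δ`, uniformly for `t` near `t₀`. A univalent function has no Koebe arcs: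
connected sets on which it is close to one point of the sphere have small diameter. So `φ t`
oscillates little near `σ`, and the Cauchy criterion gives the limits and their local uniformity.

The absence of Koebe arcs rests on `exists_dist_lt_of_near_circle`. The function `k = 1 / (h - h
z₀)` is bounded and univalent near the circle, so its image has finite area and `k'` is integrable;
the variation of `k` along radii beyond `R`, integrated over directions, tends to `0` as `R → 1`. A
connected set near the circle of diameter at least `ε` meets all radii of an arc of length `ε / 2`.
If `k` is close to `c` there, then `k - c` is small in mean on that arc of `|z| = R`. A product of
`m` rotates of a multiple of `f = (z - z₀) (k - c)`, holomorphic in the disk, is then small in mean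
on the whole circle, against the mean value property, since its value at `0` is nonzero and
independent of `R`. -/

open MeasureTheory Metric

/-! ### Directions of connected sets -/

/-- A preconnected plane set omitting the origin which contains two points of distinct
directions contains points of all directions of an arc. -/
theorem IsPreconnected.exists_arc_of_directions {C : Set ℂ} (hC : IsPreconnected C)
    (h0 : (0 : ℂ) ∉ C) {a b : ℂ} (ha : a ∈ C) (hb : b ∈ C) {ℓ : ℝ}
    (hab : ℓ ≤ ‖a / ‖a‖ - b / ‖b‖‖) :
    ∃ θ₀ : ℝ, ∀ θ ∈ Icc θ₀ (θ₀ + ℓ), ∃ s : ℝ, 0 ≤ s ∧ circleMap 0 s θ ∈ C := by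
  by_cases hall : ∀ θ : ℝ, ∃ s : ℝ, 0 ≤ s ∧ circleMap 0 s θ ∈ C
  · exact ⟨0, fun θ _ => hall θ⟩
  push Not at hall
  obtain ⟨θ₁, hθ₁⟩ := hall
  -- Rotating the missed ray to the negative real axis makes `arg` continuous on the rotated set, so
  -- its values there form an interval.
  set u : ℂ := Complex.exp ((Real.pi - θ₁ : ℝ) * Complex.I) with hu
  have hunorm : ‖u‖ = 1 := Complex.norm_exp_ofReal_mul_I _
  have hu0 : u ≠ 0 := Complex.exp_ne_zero _
  have hz : ∀ z : ℂ, z = circleMap 0 ‖z‖ ((z * u).arg - (Real.pi - θ₁)) := by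
    intro z
    have h1 := Complex.norm_mul_exp_arg_mul_I (z * u)
    rw [norm_mul, hunorm, mul_one] at h1
    have h2 : circleMap 0 ‖z‖ ((z * u).arg - (Real.pi - θ₁)) * u = z * u := by
      rw [circleMap, zero_add, mul_assoc]
      conv_rhs => rw [← h1]
      rw [hu, ← Complex.exp_add]
      congr 2
      push_cast
      ring
    exact (mul_right_cancel₀ hu0 h2).symm
  have hslit : ∀ z ∈ C, z * u ∈ Complex.slitPlane := by
    intro z hzC
    by_contra hns
    have hz0 : z ≠ 0 := fun h => h0 (h ▸ hzC)
    have harg : (z * u).arg = Real.pi := by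
      by_contra harg
      exact hns (Complex.mem_slitPlane_iff_arg.2 ⟨harg, mul_ne_zero hz0 hu0⟩)
    have := hz z
    rw [harg, sub_sub_cancel] at this
    exact hθ₁ ‖z‖ (norm_nonneg z) (this ▸ hzC)
  have hord : OrdConnected ((fun z => (z * u).arg) '' C) := by
    refine (hC.image _ ?_).ordConnected
    exact Complex.continuousOn_arg.comp (by fun_prop) hslit
  have hlen : ∀ z ∈ C, z / ‖z‖ = circleMap 0 1 ((z * u).arg - (Real.pi - θ₁)) := by
    intro z hzC
    have hz0 : (‖z‖ : ℂ) ≠ 0 := by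
      simpa using fun h : z = 0 => h0 (h ▸ hzC)
    rw [div_eq_iff hz0]
    conv_lhs => rw [hz z]
    simp [circleMap, mul_comm]
  have hdist : ‖a / ‖a‖ - b / ‖b‖‖ ≤ |(a * u).arg - (b * u).arg| := by
    rw [hlen a ha, hlen b hb]
    have := (lipschitzWith_circleMap 0 1).dist_le_mul ((a * u).arg - (Real.pi - θ₁))
      ((b * u).arg - (Real.pi - θ₁))
    simpa [dist_eq_norm] using this
  have key : ∀ a ∈ C, ∀ b ∈ C, ℓ ≤ (b * u).arg - (a * u).arg →
      ∃ θ₀ : ℝ, ∀ θ ∈ Icc θ₀ (θ₀ + ℓ), ∃ s : ℝ, 0 ≤ s ∧ circleMap 0 s θ ∈ C := by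
    intro a ha b hb hl
    refine ⟨(a * u).arg - (Real.pi - θ₁), fun θ hθ => ?_⟩
    obtain ⟨z, hzC, hzθ⟩ := hord.out (mem_image_of_mem _ ha) (mem_image_of_mem _ hb)
      (show θ + (Real.pi - θ₁) ∈ Icc _ _ from ⟨by linarith [hθ.1], by linarith [hθ.2]⟩)
    refine ⟨‖z‖, norm_nonneg z, ?_⟩
    have := hz z
    simp only at hzθ
    rw [hzθ, add_sub_cancel_right] at this
    exact this ▸ hzC
  rcases le_total (a * u).arg (b * u).arg with h | h
  · rw [abs_of_nonpos (by linarith)] at hdist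
    exact key a ha b hb (by linarith)
  · rw [abs_of_nonneg (by linarith)] at hdist
    exact key b hb a ha (by linarith)

/-! ### Area and radial variation -/

/-- The derivative of a bounded univalent function on a set of finite area is integrable. -/
theorem lintegral_enorm_deriv_ne_top {k : ℂ → ℂ} {A : Set ℂ} (hA : IsOpen A)
    (hvol : volume A ≠ ⊤) (hk : DifferentiableOn ℂ k A) (hinj : InjOn k A)
    (hbdd : Bornology.IsBounded (k '' A)) :
    ∫⁻ z in A, ‖deriv k z‖ₑ ≠ ⊤ := by
  have harea := lintegral_abs_det_fderiv_eq_addHaar_image volume hA.measurableSet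
    (fun z hz => ((hk.differentiableAt (hA.mem_nhds hz)).hasDerivAt.hasFDerivAt.restrictScalars
      ℝ).hasFDerivWithinAt) hinj
  -- By `x ≤ 1 + x ^ 2` it suffices to integrate the Jacobian `|k'|²`, which gives the area of the
  -- image.
  have hle : ∀ z ∈ A, ‖deriv k z‖ₑ ≤ 1 + ENNReal.ofReal
      |((ContinuousLinearMap.toSpanSingleton ℂ (deriv k z)).restrictScalars ℝ).det| := by
    intro z _
    have hdet : ((ContinuousLinearMap.toSpanSingleton ℂ (deriv k z)).restrictScalars ℝ).det
        = ‖deriv k z‖ ^ 2 := by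
      simp [ContinuousLinearMap.det, LinearMap.det_restrictScalars, Algebra.norm_complex_eq,
        Complex.normSq_eq_norm_sq]
    rw [hdet, ← ofReal_norm, ← ENNReal.ofReal_one,
      ← ENNReal.ofReal_add zero_le_one (abs_nonneg _), abs_of_nonneg (sq_nonneg _)]
    exact ENNReal.ofReal_le_ofReal (by nlinarith [sq_nonneg (‖deriv k z‖ - 1)])
  refine ne_top_of_le_ne_top ?_ (setLIntegral_mono' hA.measurableSet hle)
  rw [lintegral_add_left measurable_const, harea]
  simp [hvol, hbdd.measure_lt_top.ne]

/-- The radial tails of the polar integral of a function integrable on an annulus tend to `0`. -/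
theorem tendsto_lintegral_polar_annulus_zero {K : ℂ → ENNReal} (hK : Measurable K) {ρ : ℝ}
    (hρ : 0 < ρ) (hρ1 : ρ < 1) (hint : ∫⁻ z in ball 0 1 \ closedBall 0 ρ, K z ≠ ⊤) :
    Tendsto (fun R : ℝ => ∫⁻ θ in Ioo (-Real.pi) Real.pi, ∫⁻ r in Ioo R 1, K (circleMap 0 r θ))
      (𝓝[<] 1) (𝓝 0) := by
  have hvol : Tendsto (fun R : ℝ => volume (ball (0 : ℂ) 1 \ closedBall 0 R)) (𝓝[<] 1) (𝓝 0) := by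
    have h1 : Tendsto (fun R : ℝ => ENNReal.ofReal (1 ^ 2 * Real.pi - R ^ 2 * Real.pi))
        (𝓝[<] 1) (𝓝 0) := by
      have : Continuous fun R : ℝ => ENNReal.ofReal (1 ^ 2 * Real.pi - R ^ 2 * Real.pi) := by
        exact ENNReal.continuous_ofReal.comp (by fun_prop)
      simpa using (this.tendsto 1).mono_left nhdsWithin_le_nhds
    refine h1.congr' ?_
    filter_upwards [Ioo_mem_nhdsLT hρ1] with R hR
    have hR0 : 0 ≤ R := (hρ.trans hR.1).le
    rw [measure_sdiff (closedBall_subset_ball hR.2) measurableSet_closedBall.nullMeasurableSet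
      measure_closedBall_lt_top.ne, Complex.volume_ball, Complex.volume_closedBall,
      ENNReal.ofReal_sub _ (by positivity), ENNReal.ofReal_mul (by positivity),
      ENNReal.ofReal_mul (by positivity), ENNReal.ofReal_pow zero_le_one, ENNReal.ofReal_pow hR0,
      ← ENNReal.ofReal_coe_nnreal, NNReal.coe_real_pi]
  have htail : Tendsto (fun R : ℝ => ENNReal.ofReal ρ⁻¹ *
      ∫⁻ z in ball 0 1 \ closedBall 0 R, K z) (𝓝[<] 1) (𝓝 0) := by
    have h1 : Tendsto (fun R : ℝ => ∫⁻ z in (closedBall (0 : ℂ) R)ᶜ,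
        K z ∂(volume.restrict (ball 0 1 \ closedBall 0 ρ))) (𝓝[<] 1) (𝓝 0) := by
      refine tendsto_setLIntegral_zero hint ?_
      refine tendsto_of_tendsto_of_tendsto_of_le_of_le tendsto_const_nhds hvol
        (fun _ => zero_le) (fun R => ?_)
      simp only [Function.comp]
      rw [Measure.restrict_apply measurableSet_closedBall.compl]
      exact measure_mono fun z hz => ⟨hz.2.1, hz.1⟩
    have h2 := ENNReal.Tendsto.const_mul (a := ENNReal.ofReal ρ⁻¹) h1 (Or.inr ENNReal.ofReal_ne_top)
    rw [mul_zero] at h2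
    refine h2.congr' ?_
    filter_upwards [Ioo_mem_nhdsLT hρ1] with R hR
    rw [Measure.restrict_restrict measurableSet_closedBall.compl]
    congr 3
    ext z
    simp only [mem_inter_iff, mem_compl_iff, mem_closedBall, Set.mem_sdiff, mem_ball, not_le]
    constructor
    · rintro ⟨h1, h2, -⟩; exact ⟨h2, h1⟩
    · rintro ⟨h1, h2⟩; exact ⟨h2, h1, hR.1.trans h2⟩
  refine tendsto_of_tendsto_of_tendsto_of_le_of_le' tendsto_const_nhds htail
    (Eventually.of_forall fun _ => zero_le) ?_
  filter_upwards [Ioo_mem_nhdsLT hρ1] with R hR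
  have hmeas : Measurable fun p : ℝ × ℝ => K (circleMap 0 p.1 p.2) := by
    refine hK.comp (Continuous.measurable ?_)
    unfold circleMap
    fun_prop
  have hsub : Ioo R 1 ×ˢ Ioo (-Real.pi) Real.pi ⊆ polarCoord.target := by
    rw [polarCoord_target]
    exact prod_mono (fun r hr => (hρ.trans hR.1).trans hr.1) le_rfl
  have hsm : MeasurableSet (Ioo R 1 ×ˢ Ioo (-Real.pi) Real.pi) :=
    measurableSet_Ioo.prod measurableSet_Ioo
  rw [← setLIntegral_prod_symm _ hmeas.aemeasurable,
    ← lintegral_indicator (measurableSet_ball.diff measurableSet_closedBall),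
    ← Complex.lintegral_comp_polarCoord_symm]
  refine le_trans ?_ (mul_le_mul_right (lintegral_mono_set hsub) _)
  rw [← lintegral_const_mul' _ _ ENNReal.ofReal_ne_top]
  refine setLIntegral_mono' hsm fun p hp => ?_
  have hp0 : 0 < p.1 := (hρ.trans hR.1).trans hp.1.1
  have hpz : Complex.polarCoord.symm p = circleMap 0 p.1 p.2 := by
    rw [Complex.polarCoord_symm_apply, circleMap, Complex.exp_mul_I]
    simp
  have hmem : circleMap 0 p.1 p.2 ∈ ball (0 : ℂ) 1 \ closedBall 0 R := by
    simp [abs_of_pos hp0, hp.1.1, hp.1.2]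
  rw [hpz, indicator_of_mem hmem, smul_eq_mul, ← mul_assoc, ← ENNReal.ofReal_mul (by positivity)]
  -- The polar weight `r` exceeds `ρ`, so dropping it costs only the factor `ρ⁻¹`.
  have hone : 1 ≤ ENNReal.ofReal (ρ⁻¹ * p.1) := by
    rw [ENNReal.one_le_ofReal, inv_mul_eq_div, one_le_div hρ]
    exact (hR.1.trans hp.1.1).le
  calc K (circleMap 0 p.1 p.2) = 1 * K (circleMap 0 p.1 p.2) := (one_mul _).symm
    _ ≤ _ := mul_le_mul_left hone _

/-- Fundamental theorem of calculus along a radius; integrating up to `1` frees the bound from `s`.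
-/
theorem enorm_sub_le_lintegral_radial {k : ℂ → ℂ} {ρ R s θ : ℝ} (hρ : 0 ≤ ρ)
    (hk : DifferentiableOn ℂ k (ball 0 1 \ closedBall 0 ρ)) (hR : ρ < R) (hRs : R < s)
    (hs : s < 1) :
    ‖k (circleMap 0 s θ) - k (circleMap 0 R θ)‖ₑ ≤
      ∫⁻ r in Ioo R 1, ‖deriv k (circleMap 0 r θ)‖ₑ := by
  have hopen : IsOpen (ball (0 : ℂ) 1 \ closedBall 0 ρ) := isOpen_ball.sdiff isClosed_closedBall
  have hmem : ∀ r ∈ Icc R s, circleMap 0 r θ ∈ ball (0 : ℂ) 1 \ closedBall 0 ρ := by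
    intro r hr
    have hr0 : 0 ≤ r := by linarith [hr.1]
    simp only [Set.mem_sdiff, mem_ball, mem_closedBall, dist_zero_right, norm_circleMap_zero,
      abs_of_nonneg hr0, not_le]
    exact ⟨hr.2.trans_lt hs, hR.trans_le hr.1⟩
  have hcd : ContDiffOn ℝ 1 (fun r : ℝ => k (circleMap 0 r θ)) (Icc R s) := by
    have h1 : ContDiffOn ℝ 1 k (ball (0 : ℂ) 1 \ closedBall 0 ρ) :=
      (hk.contDiffOn hopen).restrict_scalars ℝ
    refine h1.comp (t := ball (0 : ℂ) 1 \ closedBall 0 ρ) ?_ hmem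
    unfold circleMap
    exact ((contDiff_const.add (Complex.ofRealCLM.contDiff.mul contDiff_const))).contDiffOn
  refine (enorm_sub_le_lintegral_deriv_of_contDiffOn_Icc hcd hRs.le).trans ?_
  rw [← restrict_Ioo_eq_restrict_Icc]
  refine (setLIntegral_congr_fun measurableSet_Ioo fun r hr => ?_).trans_le
    (lintegral_mono_set (Ioo_subset_Ioo_right hs.le))
  have hd : HasDerivAt (fun r : ℝ => circleMap 0 r θ) (Complex.exp (θ * Complex.I)) r := by
    simpa [circleMap] using (Complex.ofRealCLM.hasDerivAt (x := r)).mul_const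
      (Complex.exp (θ * Complex.I))
  have hkd := (hk.differentiableAt (hopen.mem_nhds (hmem r (Ioo_subset_Icc_self hr)))).hasDerivAt
  have hcomp := (hkd.comp r hd).deriv
  rw [Function.comp_def] at hcomp
  rw [hcomp, enorm_mul]
  simp [← ofReal_norm, Complex.norm_exp_ofReal_mul_I]

/-! ### Rotations and the mean value property -/

theorem circleMap_zero_one_mul (α r θ : ℝ) :
    circleMap 0 1 α * circleMap 0 r θ = circleMap 0 r (θ + α) := by
  simp only [circleMap, zero_add, Complex.ofReal_one, one_mul]
  rw [mul_left_comm, ← Complex.exp_add]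
  congr 2
  push_cast
  ring

/-- The rotates of an arc by the multiples of `2π / m` cover the circle if the arc is longer
than `2π / m`. -/
theorem exists_rotate_mem_arc {m : ℕ} (hm : 0 < m) {ℓ : ℝ} (hℓ : 2 * Real.pi / m ≤ ℓ) (θ₀ θ : ℝ) :
    ∃ j ∈ Finset.range m, ∃ θ' ∈ Icc θ₀ (θ₀ + ℓ), ∀ r : ℝ,
      circleMap 0 r θ' = circleMap 0 1 (2 * Real.pi * j / m) * circleMap 0 r θ := by
  have hm' : (0 : ℝ) < m := by exact_mod_cast hm
  have hd : 0 < 2 * Real.pi / m := by positivity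
  -- The first translate of `θ` by steps `2π / m` to reach `θ₀`; reducing `n` mod `m` changes the
  -- angle by full turns.
  set n : ℤ := ⌈(θ₀ - θ) / (2 * Real.pi / m)⌉ with hn
  have hn1 : (θ₀ - θ) ≤ n * (2 * Real.pi / m) := (div_le_iff₀ hd).1 (Int.le_ceil _)
  have hn2 : (n - 1) * (2 * Real.pi / m) < (θ₀ - θ) :=
    (lt_div_iff₀ hd).1 (by
      have h := Int.ceil_lt_add_one ((θ₀ - θ) / (2 * Real.pi / m))
      rw [← hn] at h
      linarith)
  have hmz : (m : ℤ) ≠ 0 := by exact_mod_cast hm.ne'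
  have hjnn := Int.emod_nonneg n hmz
  have hjlt := Int.emod_lt_of_pos n (show (0 : ℤ) < m by exact_mod_cast hm)
  refine ⟨(n % m).toNat, Finset.mem_range.2 (by omega), θ + n * (2 * Real.pi / m),
    ⟨by linarith, by linarith⟩, fun r => ?_⟩
  rw [circleMap_zero_one_mul]
  have hj : (((n % m).toNat : ℕ) : ℝ) = n - m * (n / m : ℤ) := by
    have h1 : (((n % m).toNat : ℕ) : ℤ) = n - m * (n / m) := by
      rw [Int.toNat_of_nonneg hjnn, Int.emod_def]
    exact_mod_cast h1
  have harg : θ + n * (2 * Real.pi / m) =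
      θ + 2 * Real.pi * ((n % m).toNat : ℕ) / m + (n / m : ℤ) * (2 * Real.pi) := by
    rw [hj]
    field_simp
    ring
  rw [harg]
  exact ((periodic_circleMap 0 r).int_mul _ _)

/-- One small factor suffices: this lets smallness on an arc spread to the whole circle. -/
theorem norm_prod_le_of_mem {ι : Type*} {s : Finset ι} {g : ι → ℂ} (hg : ∀ i ∈ s, ‖g i‖ ≤ 1)
    {j : ι} (hj : j ∈ s) : ‖∏ i ∈ s, g i‖ ≤ ‖g j‖ := by
  classical
  rw [norm_prod, ← Finset.mul_prod_erase s _ hj]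
  exact mul_le_of_le_one_right (norm_nonneg _) (Finset.prod_le_one (fun _ _ => norm_nonneg _)
    fun i hi => hg i (Finset.mem_of_mem_erase hi))

/-- The mean value property turned into an upper bound for the value at the centre. -/
theorem ofReal_two_pi_mul_enorm_le_lintegral {F : ℂ → ℂ} {R : ℝ} (hR0 : 0 < R) (hR : R < 1)
    (hF : DifferentiableOn ℂ F (ball 0 1)) :
    ENNReal.ofReal (2 * Real.pi) * ‖F 0‖ₑ ≤
      ∫⁻ θ in Ioo (-Real.pi) Real.pi, ‖F (circleMap 0 R θ)‖ₑ := by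
  have hd : DiffContOnCl ℂ F (ball 0 |R|) := by
    rw [abs_of_pos hR0]
    exact (hF.mono (by
      rw [closure_ball _ hR0.ne']
      exact closedBall_subset_ball hR)).diffContOnCl
  have hmean := hd.circleAverage
  rw [Real.circleAverage_def] at hmean
  have hper : Function.Periodic (fun θ => F (circleMap 0 R θ)) (2 * Real.pi) := fun θ => by
    simp only [periodic_circleMap 0 R θ]
  -- The interval of integration is moved to `(-π, π)`, the angular range of polar coordinates.
  have hshift := hper.intervalIntegral_add_eq 0 (-Real.pi)
  rw [zero_add, show -Real.pi + 2 * Real.pi = Real.pi by ring] at hshift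
  rw [hshift, intervalIntegral.integral_of_le (by linarith [Real.pi_pos]),
    integral_Ioc_eq_integral_Ioo] at hmean
  refine le_trans (le_of_eq ?_) (enorm_integral_le_lintegral_enorm _)
  rw [← hmean, enorm_smul, ← mul_assoc, Real.enorm_of_nonneg (by positivity),
    ← ENNReal.ofReal_mul (by positivity), mul_inv_cancel₀ (by positivity)]
  simp

/-! ### No Koebe arcs -/

/-- **No Koebe arcs.** Let `f` be bounded holomorphic in the disk with `f 0 ≠ 0`, controlled
near the circle by the distance of a bounded univalent function `k` from a value `c`. Then `k`
is not close to `c` on large connected sets near the circle. -/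
theorem exists_dist_lt_of_near_circle {k f : ℂ → ℂ} {ρ D : ℝ} {c : ℂ} (hρ : 0 < ρ) (hρ1 : ρ < 1)
    (hk : DifferentiableOn ℂ k (ball 0 1 \ closedBall 0 ρ))
    (hinj : InjOn k (ball 0 1 \ closedBall 0 ρ))
    (hbdd : Bornology.IsBounded (k '' (ball 0 1 \ closedBall 0 ρ)))
    (hf : DifferentiableOn ℂ f (ball 0 1)) (hf1 : ∀ z ∈ ball (0 : ℂ) 1, ‖f z‖ ≤ 1)
    (hf0 : f 0 ≠ 0) (hD : 0 < D)
    (hfk : ∀ z ∈ ball (0 : ℂ) 1 \ closedBall 0 ρ, ‖f z‖ ≤ D * ‖k z - c‖) {ε : ℝ} (hε : 0 < ε) :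
    ∃ R < 1, ∃ η > 0, ∀ C ⊆ ball (0 : ℂ) 1 \ closedBall 0 R, IsPreconnected C →
      (∀ z ∈ C, ‖k z - c‖ ≤ η) → ∀ a ∈ C, ∀ b ∈ C, dist a b < ε := by
  obtain ⟨m, hm⟩ := exists_nat_gt (2 * Real.pi / (ε / 2))
  have hm' : (0 : ℝ) < m := lt_trans (by positivity) hm
  have hm0 : 0 < m := by exact_mod_cast hm'
  have hmℓ : 2 * Real.pi / m ≤ ε / 2 := by
    rw [div_le_iff₀ hm']
    rw [div_lt_iff₀ (by positivity)] at hm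
    linarith
  have hAo : IsOpen (ball (0 : ℂ) 1 \ closedBall 0 ρ) := isOpen_ball.sdiff isClosed_closedBall
  set A := ball (0 : ℂ) 1 \ closedBall 0 ρ with hA
  set w : ℕ → ℂ := fun j => circleMap 0 1 (2 * Real.pi * j / m) with hw
  have hw1 : ∀ j, ‖w j‖ = 1 := fun j => by simp [hw]
  have hw0 : ∀ j, w j ≠ 0 := fun j h => by simpa [h] using hw1 j
  have hwball : ∀ j, MapsTo (fun z => w j * z) (ball 0 1) (ball 0 1) := fun j z hz => by
    simpa [hw1] using hz
  have hwA : ∀ j, MapsTo (fun z => w j * z) A A := fun j z hz => by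
    simpa [hA, hw1] using hz
  set K : ℂ → ENNReal := fun z => ∑ j ∈ Finset.range m, ‖deriv k (w j * z)‖ₑ with hK
  have hKj : ∀ j, Measurable fun z => ‖deriv k (w j * z)‖ₑ := fun j =>
    ((measurable_deriv k).comp (measurable_const_mul (w j))).enorm
  have hKm : Measurable K := Finset.measurable_sum _ fun j _ => hKj j
  have hKint : ∫⁻ z in A, K z ≠ ⊤ := by
    simp only [hK]
    rw [lintegral_finsetSum _ fun j _ => hKj j]
    refine ENNReal.sum_ne_top.2 fun j _ => ?_
    have hj := lintegral_enorm_deriv_ne_top (k := fun z => k (w j * z)) hAo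
      (ne_top_of_le_ne_top measure_ball_lt_top.ne (measure_mono sdiff_subset)) (hk.comp (by fun_prop) (hwA j))
      (hinj.comp (fun x _ y _ hxy => mul_left_cancel₀ (hw0 j) hxy) (hwA j))
      (hbdd.subset (by
        rintro _ ⟨z, hz, rfl⟩
        exact ⟨_, hwA j hz, rfl⟩))
    simpa [deriv_comp_mul_left, enorm_mul, ← ofReal_norm, hw1] using hj
  -- `q` is `2π |F 0|` for the product `F` below. The closeness `η` and the radial tail will
  -- contribute `q / 4` each, which stays below `q`.
  set q : ℝ := 2 * Real.pi * ‖f 0‖ ^ m with hq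
  have hq0 : 0 < q := by
    have := norm_pos_iff.2 hf0
    positivity
  have htail := tendsto_lintegral_polar_annulus_zero hKm hρ hρ1 hKint
  have hev := htail.eventually_lt_const
    (show (0 : ENNReal) < ENNReal.ofReal (q / (4 * D)) by
      rw [ENNReal.ofReal_pos]; positivity)
  -- With `R > 1 - ε / 4`, radial projection to the circle moves each of two points by at most `ε /
  -- 4`, leaving a chord of `ε / 2`.
  obtain ⟨R, hRtail, hR, hRε⟩ := (hev.and (inter_mem (Ioo_mem_nhdsLT hρ1)
    (Ioo_mem_nhdsLT (show 1 - ε / 4 < 1 by linarith)))).exists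
  have hR0 : 0 < R := hρ.trans hR.1
  refine ⟨R, hR.2, q / (8 * Real.pi * D), by positivity, fun C hC hCc hCk a ha b hb => ?_⟩
  set η := q / (8 * Real.pi * D) with hη
  by_contra! hab
  have hnorm : ∀ z ∈ C, R < ‖z‖ ∧ ‖z‖ < 1 := fun z hz => by
    have := hC hz
    simp only [Set.mem_sdiff, mem_ball, mem_closedBall, dist_zero_right, not_le] at this
    exact ⟨this.2, this.1⟩
  have hdir : ∀ z ∈ C, ‖z - z / ‖z‖‖ ≤ ε / 4 := by
    intro z hz
    have hz0 : 0 < ‖z‖ := hR0.trans (hnorm z hz).1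
    have hzc : (‖z‖ : ℂ) ≠ 0 := by exact_mod_cast hz0.ne'
    have h1 : z - z / ‖z‖ = (((‖z‖ - 1) / ‖z‖ : ℝ) : ℂ) * z := by
      push_cast
      field_simp
    rw [h1, norm_mul, Complex.norm_real, norm_div, norm_norm, div_mul_cancel₀ _ hz0.ne',
      Real.norm_eq_abs, abs_of_neg (by linarith [(hnorm z hz).2])]
    linarith [(hnorm z hz).1, hRε.1]
  have hℓ : ε / 2 ≤ ‖a / ‖a‖ - b / ‖b‖‖ := by
    have h1 : a - b = (a - a / ‖a‖) + (a / ‖a‖ - b / ‖b‖) - (b - b / ‖b‖) := by ring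
    have h2 := norm_sub_le ((a - a / ‖a‖) + (a / ‖a‖ - b / ‖b‖)) (b - b / ‖b‖)
    have h3 := norm_add_le (a - a / ‖a‖) (a / ‖a‖ - b / ‖b‖)
    rw [dist_eq_norm, h1] at hab
    linarith [hdir a ha, hdir b hb]
  obtain ⟨θ₀, hθ₀⟩ := hCc.exists_arc_of_directions
    (fun h0 => by simpa using hR0.trans (hnorm 0 h0).1) ha hb hℓ
  set F : ℂ → ℂ := fun z => ∏ j ∈ Finset.range m, f (w j * z) with hF
  have hFd : DifferentiableOn ℂ F (ball 0 1) := by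
    refine DifferentiableOn.fun_finsetProd fun j _ => ?_
    exact hf.comp (by fun_prop) (hwball j)
  have hF0 : ‖F 0‖ = ‖f 0‖ ^ m := by simp [hF]
  have hcircle : ∀ θ, circleMap 0 R θ ∈ A := fun θ => by
    simp [hA, abs_of_pos hR0, hR.1, hR.2]
  have hbound : ∀ θ : ℝ, ‖F (circleMap 0 R θ)‖ₑ ≤
      ENNReal.ofReal D * (ENNReal.ofReal η + ∫⁻ r in Ioo R 1, K (circleMap 0 r θ)) := by
    intro θ
    obtain ⟨j, hj, θ', hθ', hrot⟩ := exists_rotate_mem_arc hm0 hmℓ θ₀ θ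
    obtain ⟨s, hs0, hsC⟩ := hθ₀ θ' hθ'
    have hs := hnorm _ hsC
    rw [norm_circleMap_zero, abs_of_nonneg hs0] at hs
    have hFf : ‖F (circleMap 0 R θ)‖ₑ ≤ ENNReal.ofReal D * ‖k (circleMap 0 R θ') - c‖ₑ := by
      rw [← ofReal_norm, ← ofReal_norm, ← ENNReal.ofReal_mul hD.le]
      refine ENNReal.ofReal_le_ofReal ((norm_prod_le_of_mem (fun i _ => hf1 _ (hwball i
        (hcircle θ).1)) hj).trans ?_)
      rw [hrot]
      exact hfk _ (hwA j (hcircle θ))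
    refine hFf.trans (mul_le_mul_right ?_ _)
    have hsplit : k (circleMap 0 R θ') - c = (k (circleMap 0 s θ') - c) -
        (k (circleMap 0 s θ') - k (circleMap 0 R θ')) := by ring
    rw [hsplit]
    refine (enorm_sub_le).trans (add_le_add ?_ ?_)
    · rw [← ofReal_norm]
      exact ENNReal.ofReal_le_ofReal (hCk _ hsC)
    · refine (enorm_sub_le_lintegral_radial hρ.le hk hR.1 hs.1 hs.2).trans ?_
      refine lintegral_mono fun r => ?_
      rw [hrot]
      exact Finset.single_le_sum (f := fun j => ‖deriv k (w j * circleMap 0 r θ)‖ₑ)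
        (fun _ _ => zero_le) hj
  have hmean := ofReal_two_pi_mul_enorm_le_lintegral hR0 hR.2 hFd
  have hlt : ∫⁻ θ in Ioo (-Real.pi) Real.pi, ‖F (circleMap 0 R θ)‖ₑ <
      ENNReal.ofReal (2 * Real.pi) * ‖F 0‖ₑ := by
    calc _ ≤ ∫⁻ θ in Ioo (-Real.pi) Real.pi,
          ENNReal.ofReal D * (ENNReal.ofReal η + ∫⁻ r in Ioo R 1, K (circleMap 0 r θ)) :=
          lintegral_mono fun θ => hbound θ
      _ = ENNReal.ofReal D * (ENNReal.ofReal (η * (2 * Real.pi)) +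
          ∫⁻ θ in Ioo (-Real.pi) Real.pi, ∫⁻ r in Ioo R 1, K (circleMap 0 r θ)) := by
          rw [lintegral_const_mul' _ _ ENNReal.ofReal_ne_top, lintegral_add_left measurable_const,
            setLIntegral_const, Real.volume_Ioo, ← ENNReal.ofReal_mul (by positivity)]
          congr 4
          ring
      _ ≤ ENNReal.ofReal D * (ENNReal.ofReal (η * (2 * Real.pi)) +
          ENNReal.ofReal (q / (4 * D))) := by gcongr
      _ = ENNReal.ofReal (q / 2) := by
          rw [← ENNReal.ofReal_add (by positivity) (by positivity),
            ← ENNReal.ofReal_mul hD.le, hη]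
          congr 1
          field_simp
          norm_num
      _ < ENNReal.ofReal q := (ENNReal.ofReal_lt_ofReal_iff hq0).2 (by linarith)
      _ = _ := by
          rw [hq, ENNReal.ofReal_mul (by positivity), ← hF0, ofReal_norm]
  exact absurd hmean hlt.not_ge

/-! ### From bounded to arbitrary univalent functions -/

theorem unitDisk_eq_ball : unitDisk = ball (0 : ℂ) 1 := by
  ext z
  simp [unitDisk]

theorem isOpen_image_of_injOn_ball {h : ℂ → ℂ} (hh : DifferentiableOn ℂ h (ball 0 1))
    (hinj : InjOn h (ball 0 1)) {s : Set ℂ} (hs : s ⊆ ball 0 1) (hso : IsOpen s) :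
    IsOpen (h '' s) := by
  refine ((hh.analyticOnNhd isOpen_ball).is_constant_or_isOpen
    (convex_ball 0 1).isPreconnected).resolve_left ?_ s hs hso
  rintro ⟨w, hw⟩
  have h0 : (0 : ℂ) ∈ ball (0 : ℂ) 1 := by simp
  have h1 : (1 / 2 : ℂ) ∈ ball (0 : ℂ) 1 := by norm_num
  have := hinj h0 h1 ((hw _ h0).trans (hw _ h1).symm)
  norm_num at this

theorem exists_deriv_ne_zero_of_injOn_ball {h : ℂ → ℂ} (hh : DifferentiableOn ℂ h (ball 0 1))
    (hinj : InjOn h (ball 0 1)) : ∃ z ∈ ball (0 : ℂ) 1, deriv h z ≠ 0 := by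
  by_contra! hd
  have h0 : (0 : ℂ) ∈ ball (0 : ℂ) 1 := by simp
  have h1 : (1 / 2 : ℂ) ∈ ball (0 : ℂ) 1 := by norm_num
  have := hinj h0 h1 (isOpen_ball.is_const_of_deriv_eq_zero (convex_ball 0 1).isPreconnected hh
    (fun z hz => hd z hz) h0 h1)
  norm_num at this

/-- **No Koebe arcs for univalent functions.** If the image of a univalent function `h` of the
disk under `w ↦ (w - h z₀)⁻¹` leaves out the limit `c` of this map along `l`, then connected
sets on which `h` is close to `l` are small. -/
theorem exists_dist_lt_of_univalent_aux {h : ℂ → ℂ} (hh : DifferentiableOn ℂ h (ball 0 1))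
    (hinj : InjOn h (ball 0 1)) {z₀ : ℂ} (hz₀ : z₀ ∈ ball (0 : ℂ) 1) (hd : deriv h z₀ ≠ 0)
    {l : Filter ℂ} {c : ℂ} (hlc : Tendsto (fun w => (w - h z₀)⁻¹) l (𝓝 c))
    (hc : ∀ z ∈ ball (0 : ℂ) 1, z ≠ z₀ → (h z - h z₀)⁻¹ ≠ c)
    (hcompact : ∀ s ⊆ ball (0 : ℂ) 1, IsCompact s → (h '' s)ᶜ ∈ l) {ε : ℝ} (hε : 0 < ε) :
    ∃ V ∈ l, ∀ C ⊆ ball (0 : ℂ) 1, IsPreconnected C → MapsTo h C V →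
      ∀ a ∈ C, ∀ b ∈ C, dist a b < ε := by
  have hz₀' : ‖z₀‖ < 1 := by simpa using hz₀
  obtain ⟨ρ, hρz, hρ1⟩ := exists_between hz₀'
  have hρ : 0 < ρ := (norm_nonneg _).trans_lt hρz
  have hρball : ball (0 : ℂ) ρ ⊆ ball 0 1 := ball_subset_ball hρ1.le
  obtain ⟨r, hr, hrsub⟩ := Metric.isOpen_iff.1 (isOpen_image_of_injOn_ball hh hinj hρball
    isOpen_ball) (h z₀) ⟨z₀, by simpa using hρz, rfl⟩
  set A := ball (0 : ℂ) 1 \ closedBall 0 ρ with hA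
  have hA1 : A ⊆ ball 0 1 := sdiff_subset
  -- Values within `r` of `h z₀` are already taken in `ball 0 ρ`, so injectivity keeps `h` away from
  -- them on `A`; hence `k` is bounded.
  have hAr : ∀ z ∈ A, r ≤ ‖h z - h z₀‖ := by
    intro z hz
    by_contra! hlt
    obtain ⟨z', hz', heq⟩ := hrsub (mem_ball_iff_norm.2 hlt)
    exact hz.2 (hinj (hρball hz') (hA1 hz) heq ▸ ball_subset_closedBall hz')
  have hA0 : ∀ z ∈ A, h z - h z₀ ≠ 0 := fun z hz => norm_pos_iff.1 (hr.trans_le (hAr z hz))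
  set k : ℂ → ℂ := fun z => (h z - h z₀)⁻¹ with hk
  have hkd : DifferentiableOn ℂ k A := ((hh.mono hA1).sub_const _).inv hA0
  have hkinj : InjOn k A := fun x hx y hy hxy =>
    hinj (hA1 hx) (hA1 hy) (sub_left_injective (inv_injective hxy))
  have hkr : ∀ z ∈ A, ‖k z‖ ≤ r⁻¹ := fun z hz => by
    rw [hk, norm_inv]
    exact inv_anti₀ hr (hAr z hz)
  have hkb : Bornology.IsBounded (k '' A) :=
    isBounded_iff_forall_norm_le.2 ⟨r⁻¹, by rintro _ ⟨z, hz, rfl⟩; exact hkr z hz⟩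
  have hslope : DifferentiableOn ℂ (dslope h z₀) (ball 0 1) :=
    (Complex.differentiableOn_dslope (isOpen_ball.mem_nhds hz₀)).2 hh
  have hslope0 : ∀ z ∈ ball (0 : ℂ) 1, dslope h z₀ z ≠ 0 := by
    intro z hz
    by_cases hzz : z = z₀
    · rwa [hzz, dslope_same]
    · rw [dslope_of_ne _ hzz, slope_def_field]
      exact div_ne_zero (sub_ne_zero.2 fun he => hzz (hinj hz hz₀ he)) (sub_ne_zero.2 hzz)
  -- This is `(z - z₀) (k z - c)` with its singularity at `z₀` removed; its value there is `1 /
  -- h'(z₀)`.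
  set f : ℂ → ℂ := fun z => (dslope h z₀ z)⁻¹ - c * (z - z₀) with hf
  have hfd : DifferentiableOn ℂ f (ball 0 1) :=
    (hslope.inv hslope0).sub (by fun_prop)
  have hfne : ∀ z, z ≠ z₀ → f z = (z - z₀) * (k z - c) := by
    intro z hzz
    simp only [hf, hk]
    rw [dslope_of_ne _ hzz, slope_def_field, inv_div]
    ring
  have hf0 : f 0 ≠ 0 := by
    by_cases hzz : 0 = z₀
    · have hfz : f z₀ ≠ 0 := by
        simp only [hf, dslope_same, sub_self, mul_zero, sub_zero]
        exact inv_ne_zero hd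
      rwa [← hzz] at hfz
    · rw [hfne 0 hzz]
      exact mul_ne_zero (sub_ne_zero.2 hzz) (sub_ne_zero.2 (hc 0 (by simp) hzz))
  have hfk : ∀ z ∈ A, ‖f z‖ ≤ 2 * ‖k z - c‖ := by
    intro z hz
    rw [hfne z fun he => hA0 z hz (by rw [he, sub_self]), norm_mul]
    have hz1 : ‖z‖ < 1 := by simpa using hA1 hz
    gcongr
    linarith [norm_sub_le z z₀]
  obtain ⟨M, hM⟩ := (isCompact_closedBall (0 : ℂ) ρ).exists_bound_of_continuousOn
    (hfd.continuousOn.mono (closedBall_subset_ball hρ1))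
  set B := max 1 (max M (2 * (r⁻¹ + ‖c‖))) with hB
  have hB0 : 0 < B := lt_max_of_lt_left one_pos
  have hfB : ∀ z ∈ ball (0 : ℂ) 1, ‖f z‖ ≤ B := by
    intro z hz
    by_cases hzρ : z ∈ closedBall (0 : ℂ) ρ
    · exact (hM z hzρ).trans ((le_max_left _ _).trans (le_max_right _ _))
    · refine le_trans ?_ ((le_max_right _ _).trans (le_max_right _ _))
      refine (hfk z ⟨hz, hzρ⟩).trans ?_
      have := norm_sub_le (k z) c
      have := hkr z ⟨hz, hzρ⟩
      linarith
  obtain ⟨R, hR1, η, hη, hRη⟩ := exists_dist_lt_of_near_circle (f := fun z => f z / B)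
    (D := 2 / B) (c := c) hρ hρ1 hkd hkinj hkb (hfd.div_const _)
    (fun z hz => by
      rw [norm_div, Complex.norm_real, Real.norm_of_nonneg hB0.le, div_le_one hB0]
      exact hfB z hz)
    (div_ne_zero hf0 (by exact_mod_cast hB0.ne')) (by positivity)
    (fun z hz => by
      rw [norm_div, Complex.norm_real, Real.norm_of_nonneg hB0.le, div_mul_eq_mul_div]
      gcongr
      exact hfk z hz) hε
  -- Removing the image of `closedBall 0 R` from `V` forces `C` into the annulus.
  refine ⟨_, inter_mem (hcompact _ (closedBall_subset_ball hR1) (isCompact_closedBall 0 R))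
    (hlc (closedBall_mem_nhds c hη)), fun C hC hCc hCV => hRη C (fun z hz => ⟨hC hz, fun hzR =>
      (hCV hz).1 (mem_image_of_mem h hzR)⟩) hCc fun z hz => ?_⟩
  simpa [dist_eq_norm] using (hCV hz).2

theorem exists_dist_lt_of_univalent_cobounded {h : ℂ → ℂ} (hh : DifferentiableOn ℂ h (ball 0 1))
    (hinj : InjOn h (ball 0 1)) {ε : ℝ} (hε : 0 < ε) :
    ∃ V ∈ Bornology.cobounded ℂ, ∀ C ⊆ ball (0 : ℂ) 1, IsPreconnected C → MapsTo h C V →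
      ∀ a ∈ C, ∀ b ∈ C, dist a b < ε := by
  obtain ⟨z₀, hz₀, hd⟩ := exists_deriv_ne_zero_of_injOn_ball hh hinj
  refine exists_dist_lt_of_univalent_aux hh hinj hz₀ hd (c := 0) ?_ ?_ ?_ hε
  · exact tendsto_inv₀_cobounded.comp (tendsto_sub_const_cobounded _)
  · exact fun z hz hzz => inv_ne_zero (sub_ne_zero.2 fun he => hzz (hinj hz hz₀ he))
  · exact fun s hs hsc =>
      Bornology.isBounded_def.1 (hsc.image_of_continuousOn (hh.continuousOn.mono hs)).isBounded

theorem exists_dist_lt_of_univalent_nhds {h : ℂ → ℂ} (hh : DifferentiableOn ℂ h (ball 0 1))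
    (hinj : InjOn h (ball 0 1)) (v : ℂ) {ε : ℝ} (hε : 0 < ε) :
    ∃ V ∈ 𝓝 v, ∀ C ⊆ ball (0 : ℂ) 1, IsPreconnected C → MapsTo h C V →
      ∀ a ∈ C, ∀ b ∈ C, dist a b < ε := by
  -- Near an attained value the inverse of `h` is continuous; an omitted value gives a `c` omitted
  -- by `k` off `z₀`.
  by_cases hv : v ∈ h '' ball 0 1
  · obtain ⟨p, hp, rfl⟩ := hv
    have hsub : ball p (ε / 2) ∩ ball 0 1 ⊆ ball 0 1 := inter_subset_right
    refine ⟨_, (isOpen_image_of_injOn_ball hh hinj hsub (isOpen_ball.inter isOpen_ball)).mem_nhds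
      (mem_image_of_mem h ⟨mem_ball_self (half_pos hε), hp⟩), fun C hC _ hCV => ?_⟩
    have hCp : ∀ a ∈ C, dist a p < ε / 2 := by
      intro a ha
      obtain ⟨a', ha', he⟩ := hCV ha
      exact hinj ha'.2 (hC ha) he ▸ ha'.1
    intro a ha b hb
    linarith [dist_triangle_right a b p, hCp a ha, hCp b hb]
  · obtain ⟨z₀, hz₀, hd⟩ := exists_deriv_ne_zero_of_injOn_ball hh hinj
    have hne : v - h z₀ ≠ 0 := sub_ne_zero.2 fun he => hv ⟨z₀, hz₀, he.symm⟩
    refine exists_dist_lt_of_univalent_aux hh hinj hz₀ hd (c := (v - h z₀)⁻¹) ?_ ?_ ?_ hε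
    · exact (tendsto_id.sub_const _).inv₀ hne
    · exact fun z hz _ he => hv ⟨z, hz, sub_left_injective (inv_injective he)⟩
    · exact fun s hs hsc => (hsc.image_of_continuousOn
        (hh.continuousOn.mono hs)).isClosed.isOpen_compl.mem_nhds fun hvs => hv (image_mono hs hvs)

/-! ### Boundary limits of the semigroup -/

/-- Near a boundary point at which the Koenigs function has a limit, the oscillation of the
semigroup is small, locally uniformly in time. -/
theorem eventually_dist_lt_of_koenigs_limit {φ : ℝ≥0 → ℂ → ℂ} (hφ : IsOneParameterSemigroup φ)
    {h : ℂ → ℂ} (hh : IsKoenigsFunction φ h) {σ : ℂ}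
    (hlim : (∃ L : ℂ, HasUnrestrictedLimit h σ L) ∨ HasInfiniteUnrestrictedLimit h σ)
    (t₀ : ℝ≥0) {ε : ℝ} (hε : 0 < ε) :
    ∃ U ∈ 𝓝 t₀, ∃ δ > 0, ∀ t ∈ U, ∀ z ∈ ball σ δ ∩ unitDisk, ∀ w ∈ ball σ δ ∩ unitDisk,
      dist (φ t z) (φ t w) < ε := by
  have hd : DifferentiableOn ℂ h (ball 0 1) := unitDisk_eq_ball ▸ hh.holomorphic
  have hinj : InjOn h (ball 0 1) := unitDisk_eq_ball ▸ hh.univalent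
  obtain ⟨l, V, hV, hl, hVC⟩ : ∃ (l : Filter ℂ) (V : Set ℂ), V ∈ l ∧
      Tendsto (fun p : ℝ≥0 × ℂ => h p.2 + ((p.1 : ℝ) : ℂ)) (𝓝 t₀ ×ˢ 𝓝[unitDisk] σ) l ∧
      ∀ C ⊆ ball (0 : ℂ) 1, IsPreconnected C → MapsTo h C V → ∀ a ∈ C, ∀ b ∈ C, dist a b < ε := by
    have htime : Tendsto (fun p : ℝ≥0 × ℂ => ((p.1 : ℝ) : ℂ)) (𝓝 t₀ ×ˢ 𝓝[unitDisk] σ)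
        (𝓝 ((t₀ : ℝ) : ℂ)) :=
      ((Complex.continuous_ofReal.comp NNReal.continuous_coe).tendsto t₀).comp tendsto_fst
    rcases hlim with ⟨L, hL⟩ | hinf
    · obtain ⟨V, hV, hVC⟩ := exists_dist_lt_of_univalent_nhds hd hinj (L + ((t₀ : ℝ) : ℂ)) hε
      exact ⟨_, V, hV, (Tendsto.comp hL tendsto_snd).add htime, hVC⟩
    · obtain ⟨V, hV, hVC⟩ := exists_dist_lt_of_univalent_cobounded hd hinj hε
      refine ⟨_, V, hV, ?_, hVC⟩
      have hnorm := (tendsto_norm_atTop_iff_cobounded.2 (Tendsto.comp hinf tendsto_snd)).atTop_add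
        htime.norm.neg
      refine tendsto_norm_atTop_iff_cobounded.1 (tendsto_atTop_mono (fun p => ?_) hnorm)
      have := norm_sub_le (h p.2 + ((p.1 : ℝ) : ℂ)) ((p.1 : ℝ) : ℂ)
      rw [add_sub_cancel_right] at this
      simp only [Function.comp]
      linarith
  obtain ⟨U, hU, W, hW, hUW⟩ := mem_prod_iff.1 (hl hV)
  obtain ⟨δ, hδ, hδW⟩ := Metric.mem_nhdsWithin_iff.1 hW
  refine ⟨U, hU, δ, hδ, fun t ht z hz w hw => ?_⟩
  refine hVC (φ t '' (ball σ δ ∩ unitDisk)) ?_ ?_ ?_ _ (mem_image_of_mem _ hz) _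
    (mem_image_of_mem _ hw)
  · rintro _ ⟨x, hx, rfl⟩
    exact unitDisk_eq_ball ▸ hφ.mapsTo t hx.2
  · refine IsPreconnected.image ?_ _ ((hφ.holomorphic t).continuousOn.mono inter_subset_right)
    rw [unitDisk_eq_ball]
    exact ((convex_ball σ δ).inter (convex_ball 0 1)).isPreconnected
  · rintro _ ⟨x, hx, rfl⟩
    rw [hh.abel t x hx.2]
    exact hUW (mk_mem_prod ht (hδW hx))

theorem proposition4p6 (φ : ℝ≥0 → ℂ → ℂ) (hφ : IsOneParameterSemigroup φ)
    (τ : ℂ) (hτ : ‖τ‖ = 1) (hDW : IsSemigroupDenjoyWolffPoint φ τ)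
    (h : ℂ → ℂ) (hh : IsKoenigsFunction φ h)
    (σ : ℂ) (hσ : ‖σ‖ = 1)
    (hlim : (∃ L : ℂ, HasUnrestrictedLimit h σ L) ∨ HasInfiniteUnrestrictedLimit h σ) :
    ∃ φσ : ℝ≥0 → ℂ,
      (∀ t, HasAngularLimit (φ t) σ (φσ t)) ∧
      (∀ t, HasUnrestrictedLimit (φ t) σ (φσ t)) ∧
      TendstoLocallyUniformly (fun (z : ℂ) (t : ℝ≥0) => φ t z) φσ (𝓝[unitDisk] σ) := by
  have hne : (𝓝[unitDisk] σ).NeBot := by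
    rw [← mem_closure_iff_nhdsWithin_neBot, unitDisk_eq_ball, closure_ball _ one_ne_zero]
    simp [hσ]
  have hnear : ∀ δ > 0, ball σ δ ∩ unitDisk ∈ 𝓝[unitDisk] σ := fun δ hδ =>
    Metric.mem_nhdsWithin_iff.2 ⟨δ, hδ, le_rfl⟩
  have hosc := fun t₀ {ε : ℝ} (hε : 0 < ε) => eventually_dist_lt_of_koenigs_limit hφ hh hlim t₀ hε
  have hex : ∀ t, ∃ a, Tendsto (φ t) (𝓝[unitDisk] σ) (𝓝 a) := by
    intro t
    refine cauchy_map_iff_exists_tendsto.1 (Metric.cauchy_iff.2 ⟨hne.map _, fun ε hε => ?_⟩)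
    obtain ⟨U, hU, δ, hδ, hUδ⟩ := hosc t hε
    refine ⟨_, image_mem_map (hnear δ hδ), ?_⟩
    rintro _ ⟨z, hz, rfl⟩ _ ⟨w, hw, rfl⟩
    exact hUδ t (mem_of_mem_nhds hU) z hz w hw
  choose φσ hφσ using hex
  refine ⟨φσ, fun t M _ => (hφσ t).mono_left (nhdsWithin_mono _ fun z hz => hz.1), hφσ, ?_⟩
  rw [Metric.tendstoLocallyUniformly_iff]
  intro ε hε t₀
  obtain ⟨U, hU, δ, hδ, hUδ⟩ := hosc t₀ (half_pos hε)
  refine ⟨U, hU, ?_⟩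
  filter_upwards [hnear δ hδ] with z hz t ht
  refine lt_of_le_of_lt ?_ (half_lt_self hε)
  -- Letting `w → σ` with `z` fixed turns the oscillation bound into a rate uniform in `t ∈ U`.
  refine le_of_tendsto ((hφσ t).dist tendsto_const_nhds) ?_
  filter_upwards [hnear δ hδ] with w hw
  exact (hUδ t ht w hw z hz).le
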